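/- Let $n\ge 1$ and let $W(A_n)$ be the Coxeter group of type $A_n$ with generators $\sigma_1,\dots,\sigma_n$ ($\sigma_a,\sigma_b$ commute iff $|a-b|\ne 1$, and $m_{ab}=3$ if $|a-b|=1$). An element $w$ is fully commutative (FC) if any reduced expression of $w$ can be obtained from any other by commutation relations only. For $1\le i\le j\le n$ put $[i,j]=\sigma_i\sigma_{i+1}\cdots\sigma_j$. Every FC element has a unique canonical form $$w=[i_1,j_1][i_2,j_2]\cdots[i_p,j_p],\qquad n\ge i_1>\dots>i_p\ge 1,\quad n\ge j_1>\dots>j_p\ge 1,\quad i_t\le j_t\ (1\le t\le p),$$ and $p$ is called the size of $w$ (the identity has size $0$). The element $w\neq 1$ has first block $[i_1,j_1]$ and last block $[i_p,j_p]$; it starts with $\sigma_{i_1}$ and ends with $\sigma_{j_p}$. Then: 1. For $1\le i\le j\le n$, the number of FC elements of $W(A_n)$ with first block $[i,j]$ is $$\frac{j-i+2}{j+1}\binom{j+i-1}{j},$$ and the number of those with last block $[i,j]$ is $$\frac{j-i+2}{n-i+2}\binom{2n-j-i+1}{n-j}.$$ 2. For $1\le i,j\le n$ and $1\le p\le n$,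 the number of FC elements of size $p$ starting with $\sigma_i$ is $$\frac{n+1-i}{n+1-p}\binom{i-1}{p-1}\binom{n}{p},$$ and the number of FC elements of size $p$ ending with $\sigma_j$ is $$\frac{j}{n+1-p}\binom{n-j}{p-1}\binom{n}{p}.$$ 3. For $1\le i\le j\le n$, the number of FC elements starting with $\sigma_i$ and ending with $\sigma_j$ is $\binom{n-j+i-1}{i-1}$. For $2\le i\le n$, the number of FC elements starting with $\sigma_i$ and ending with $\sigma_{i-1}$ is $\binom{n}{i-1}-1$. -/

import Mathlib

namespace FCTypeA

section FullyCommutative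

variable {B W : Type*} [Group W] {M : CoxeterMatrix B}

/-- One commutation move on words: two adjacent letters `s`, `t` with `m_{st} = 2` are exchanged. -/
def CommMove (M : CoxeterMatrix B) (u v : List B) : Prop :=
  ∃ (a b : List B) (s t : B), M s t = 2 ∧ u = a ++ [s, t] ++ b ∧ v = a ++ [t, s] ++ b

/-- `w` is fully commutative: any reduced expression of `w` can be obtained from any other one
using only commutation moves. -/
def IsFC (cs : CoxeterSystem M W) (w : W) : Prop :=
  ∀ u v : List B, cs.IsReduced u → cs.IsReduced v → cs.wordProd u = w → cs.wordProd v = w →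
    Relation.ReflTransGen (CommMove M) u v

end FullyCommutative

/-- The word `σ_i σ_{i+1} ⋯ σ_j` written `[i, j]`. Generators are numbered `1, …, n`; the generator
`σ_k` is the simple reflection with index `k - 1` in `Fin n`. -/
def block (n i j : ℕ) : List (Fin n) :=
  (List.finRange n).filter fun k => i ≤ (k : ℕ) + 1 ∧ (k : ℕ) + 1 ≤ j

/-- Standard `p`-pairs `(i_1, j_1), …, (i_p, j_p)` (where `p` is the length of the list):
`1 ≤ i_t ≤ j_t ≤ n` for all `t`, `i_1 > ⋯ > i_p` and `j_1 > ⋯ > j_p`. -/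
def IsStandard (n : ℕ) (L : List (ℕ × ℕ)) : Prop :=
  (∀ a ∈ L, 1 ≤ a.1 ∧ a.1 ≤ a.2 ∧ a.2 ≤ n) ∧
    L.Pairwise fun a b => b.1 < a.1 ∧ b.2 < a.2

/-- The word `[i_1, j_1] [i_2, j_2] ⋯ [i_p, j_p]`. -/
def canonicalWord (n : ℕ) (L : List (ℕ × ℕ)) : List (Fin n) :=
  L.flatMap fun a => block n a.1 a.2

variable {W : Type*} [Group W] {n : ℕ}

/-- `[i_1, j_1] ⋯ [i_p, j_p]` is a canonical form of `w`. -/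
def IsCanonicalForm (cs : CoxeterSystem (CoxeterMatrix.A n) W) (w : W) (L : List (ℕ × ℕ)) : Prop :=
  IsStandard n L ∧ cs.wordProd (canonicalWord n L) = w

/-- The fully commutative elements of `W(A_n)` whose canonical form satisfies `P`. -/
def fcWith (cs : CoxeterSystem (CoxeterMatrix.A n) W) (P : List (ℕ × ℕ) → Prop) : Set W :=
  {w | IsFC cs w ∧ ∃ L, IsCanonicalForm cs w L ∧ P L}

/-- The first block is `[i, j]`, that is, `(i_1, j_1) = (i, j)`. -/
def FirstBlock (i j : ℕ) (L : List (ℕ × ℕ)) : Prop := L.head? = some (i, j)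

/-- The last block is `[i, j]`, that is, `(i_p, j_p) = (i, j)`. -/
def LastBlock (i j : ℕ) (L : List (ℕ × ℕ)) : Prop := L.getLast? = some (i, j)

/-- The canonical word starts with `σ_i` on the left: `i_1 = i`. -/
def StartsWith (i : ℕ) (L : List (ℕ × ℕ)) : Prop := ∃ j, FirstBlock i j L

/-- The canonical word ends with `σ_j` on the right: `j_p = j`. -/
def EndsWith (j : ℕ) (L : List (ℕ × ℕ)) : Prop := ∃ i, LastBlock i j L

end FCTypeA

namespace FCTypeA

/-! ### Words and blocks -/

/-! Distinct standard lists give distinct FC elements, so every statement becomes a count of lists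
of pairs. To see this, let words permute `ℕ`, leftmost letter first. The block $[i,j]$ sends $i-1$
to $j$ and shifts $i,\dots,j$ down by one; hence a canonical word sends each $i_t-1$ to $j_t$ and
maps all other points increasingly, never raising them. Its permutation splits into two increasing
sequences, so it avoids 321, and its excedances spell out the list (`isStandard_eq_of_act_eq`).

A reduced word whose permutation avoids 321 has no factor `s s` or `s t s` anywhere in its
commutation class (`noShortening_of_isReduced`, resting on the exchange property
`exists_shorter_reflection_mul`). Such a word can be sorted by commutations into a canonical word
(`exists_canonicalWord_commEquiv`). Thus every reduced word of a canonical element sorts to a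
canonical word with the same permutation, hence to the same canonical word; this is full
commutativity (`isFC_of_isStandard`). Neither faithfulness of the permutation action nor reducedness
of canonical words is needed.

For the counts, deleting the first block gives a recursion with a double sum over the next block
(`count_eq`). Ballot numbers, differences of products of binomials, and multiset coefficients solve
it for no condition, prescribed size and prescribed last letter respectively, because both sums
telescope. The formulas for last blocks and for size with last letter follow by reversing the
diagram and inverting (`ncard_flipBlocks`). -/

theorem mem_block {n i j : ℕ} {k : Fin n} :
    k ∈ block n i j ↔ i ≤ (k : ℕ) + 1 ∧ (k : ℕ) + 1 ≤ j := by
  simp [block]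

theorem block_pairwise (n i j : ℕ) : (block n i j).Pairwise (· < ·) :=
  (List.pairwise_lt_finRange n).filter _

/-- Blocks are strictly increasing lists, hence determined by their members, so splitting them
reduces to inequalities. -/
theorem block_append {n i j k : ℕ} (hik : i ≤ k + 1) (hkj : k ≤ j) :
    block n i k ++ block n (k + 1) j = block n i j := by
  refine List.Pairwise.eq_of_mem_iff (r := (· < ·)) ?_ (block_pairwise n i j) ?_
  · refine List.pairwise_append.2 ⟨block_pairwise _ _ _, block_pairwise _ _ _, ?_⟩
    intro a ha b hb
    rw [mem_block] at ha hb
    rw [Fin.lt_def]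
    omega
  · intro a
    rw [List.mem_append, mem_block, mem_block, mem_block]
    omega

theorem block_self {n : ℕ} (c : Fin n) : block n (c + 1) (c + 1) = [c] := by
  refine List.Pairwise.eq_of_mem_iff (r := (· < ·)) (block_pairwise n _ _) (by simp) ?_
  intro a
  rw [mem_block, List.mem_singleton, Fin.ext_iff]
  omega

theorem block_cons {n j : ℕ} (c : Fin n) (h : (c : ℕ) + 1 ≤ j) :
    block n (c + 1) j = c :: block n (c + 2) j := by
  rw [← block_append (k := c + 1) (by omega) h, block_self]
  rfl

theorem block_eq_nil {n i j : ℕ} (h : j < i) : block n i j = [] := by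
  rw [List.eq_nil_iff_forall_not_mem]
  intro a
  rw [mem_block]
  omega

theorem coxeterMatrix_A_eq_two {n : ℕ} {s t : Fin n} :
    CoxeterMatrix.A n s t = 2 ↔ (s : ℕ) + 1 < t ∨ (t : ℕ) + 1 < s := by
  have : CoxeterMatrix.A n s t = if s = t then 1
      else (if (t : ℕ) + 1 = s ∨ (s : ℕ) + 1 = t then 3 else 2) := rfl
  rw [this]
  split_ifs with h1 h2
  · subst h1; omega
  · omega
  · rw [Fin.ext_iff] at h1; omega

theorem coxeterMatrix_A_of_succ {n : ℕ} {s t : Fin n} (h : (s : ℕ) + 1 = t) :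
    CoxeterMatrix.A n s t = 3 := by
  have : CoxeterMatrix.A n s t = if s = t then 1
      else (if (t : ℕ) + 1 = s ∨ (s : ℕ) + 1 = t then 3 else 2) := rfl
  rw [this, if_neg (by rw [Fin.ext_iff]; omega), if_pos (Or.inr h)]

/-! ### Commutation classes of words -/

section Comm

open Relation

variable {B : Type*} {M : CoxeterMatrix B}

/-- Commutation equivalence of words. -/
abbrev CommEquiv (M : CoxeterMatrix B) : List B → List B → Prop := ReflTransGen (CommMove M)

theorem CommMove.symm {u v : List B} (h : CommMove M u v) : CommMove M v u := by
  obtain ⟨a, b, s, t, hst, rfl, rfl⟩ := h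
  exact ⟨a, b, t, s, by rw [M.symmetric]; exact hst, rfl, rfl⟩

theorem CommEquiv.symm {u v : List B} (h : CommEquiv M u v) : CommEquiv M v u := by
  induction h with
  | refl => exact .refl
  | tail _ h ih => exact ReflTransGen.head h.symm ih

theorem CommEquiv.append {u v : List B} (h : CommEquiv M u v) (a b : List B) :
    CommEquiv M (a ++ u ++ b) (a ++ v ++ b) := by
  induction h with
  | refl => exact .refl
  | tail _ h ih =>
    refine ih.tail ?_
    obtain ⟨c, d, s, t, hst, rfl, rfl⟩ := h
    exact ⟨a ++ c, d ++ b, s, t, hst, by simp, by simp⟩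

theorem CommEquiv.cons {u v : List B} (h : CommEquiv M u v) (c : B) :
    CommEquiv M (c :: u) (c :: v) := by
  simpa using h.append [c] []

theorem commEquiv_cons_append {c : B} : ∀ {u : List B} (v : List B), (∀ d ∈ u, M c d = 2) →
    CommEquiv M (c :: (u ++ v)) (u ++ c :: v)
  | [], _, _ => .refl
  | d :: u, v, h => by
    have h1 : CommEquiv M (c :: d :: (u ++ v)) (d :: c :: (u ++ v)) :=
      .single ⟨[], u ++ v, c, d, h d (by simp), by simp, by simp⟩
    exact h1.trans ((commEquiv_cons_append v fun e he => h e (by simp [he])).cons d)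

end Comm

/-- The word has a factor `s s`, or a factor `s t s` with `s`, `t` adjacent generators. -/
def HasShortening {n : ℕ} (v : List (Fin n)) : Prop :=
  (∃ (a b : List (Fin n)) (s : Fin n), v = a ++ [s, s] ++ b) ∨
    ∃ (a b : List (Fin n)) (s t : Fin n), ((s : ℕ) + 1 = t ∨ (t : ℕ) + 1 = s) ∧
      v = a ++ [s, t, s] ++ b

theorem HasShortening.append {n : ℕ} {v : List (Fin n)} (h : HasShortening v)
    (a b : List (Fin n)) : HasShortening (a ++ v ++ b) := by
  obtain ⟨c, d, s, rfl⟩ | ⟨c, d, s, t, hst, rfl⟩ := h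
  · exact Or.inl ⟨a ++ c, d ++ b, s, by simp⟩
  · exact Or.inr ⟨a ++ c, d ++ b, s, t, hst, by simp⟩

/-- No word in the commutation class of `v` has a factor `s s` or `s t s`. -/
def NoShortening {n : ℕ} (v : List (Fin n)) : Prop :=
  ∀ v', CommEquiv (CoxeterMatrix.A n) v v' → ¬ HasShortening v'

theorem NoShortening.of_cons {n : ℕ} {c : Fin n} {v : List (Fin n)} (h : NoShortening (c :: v)) :
    NoShortening v := by
  intro v' hv hs
  refine h (c :: v') (hv.cons c) ?_
  simpa using hs.append [c] []

theorem NoShortening.of_commEquiv {n : ℕ} {u v : List (Fin n)} (h : NoShortening u)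
    (huv : CommEquiv (CoxeterMatrix.A n) u v) : NoShortening v :=
  fun v' hv => h v' (huv.trans hv)

theorem canonicalWord_cons (n : ℕ) (a : ℕ × ℕ) (L : List (ℕ × ℕ)) :
    canonicalWord n (a :: L) = block n a.1 a.2 ++ canonicalWord n L := by
  simp [canonicalWord]

theorem isStandard_cons {n : ℕ} {a : ℕ × ℕ} {L : List (ℕ × ℕ)} :
    IsStandard n (a :: L) ↔ (1 ≤ a.1 ∧ a.1 ≤ a.2 ∧ a.2 ≤ n) ∧
      (∀ b ∈ L, b.1 < a.1 ∧ b.2 < a.2) ∧ IsStandard n L := by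
  simp only [IsStandard, List.mem_cons, forall_eq_or_imp, List.pairwise_cons]
  tauto

theorem isStandard_nil {n : ℕ} : IsStandard n [] := by
  simp [IsStandard]

/-- Insertion of one letter: it opens a new block, extends a block to the left, or slides past the
first block; any other position creates a forbidden factor. The last clause of the conclusion is
what keeps the blocks in order when the recursion puts the first block back. -/
theorem exists_canonicalWord_commEquiv_cons {n : ℕ} (c : Fin n) :
    ∀ {L : List (ℕ × ℕ)}, IsStandard n L → NoShortening (c :: canonicalWord n L) →
      ∃ L', IsStandard n L' ∧
        CommEquiv (CoxeterMatrix.A n) (c :: canonicalWord n L) (canonicalWord n L') ∧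
        ∀ b ∈ L', (b.1 = (c : ℕ) + 1 ∨ ∃ a ∈ L, b.1 = a.1) ∧
          (b.2 = (c : ℕ) + 1 ∨ ∃ a ∈ L, b.2 = a.2)
  | [], _, _ => by
    refine ⟨[(c + 1, c + 1)], ?_, ?_, by simp⟩
    · rw [isStandard_cons]
      exact ⟨⟨by simp, le_rfl, c.2⟩, by simp, isStandard_nil⟩
    · rw [canonicalWord_cons, block_self]
      exact .refl
  | (i, j) :: L, hL, hgood => by
    have hL' := hL
    rw [isStandard_cons] at hL
    obtain ⟨⟨h1i, hij, hjn⟩, hlt, hstd⟩ := hL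
    dsimp only at h1i hij hjn hlt
    rcases lt_or_ge j (c + 1) with hjc | hjc
    · -- a new first block
      refine ⟨(c + 1, c + 1) :: (i, j) :: L, ?_, ?_, ?_⟩
      · rw [isStandard_cons]
        refine ⟨⟨by simp, le_rfl, c.2⟩, ?_, hL'⟩
        intro b hb
        rcases List.mem_cons.1 hb with rfl | hb
        · dsimp only; omega
        · have := hlt b hb; dsimp only; omega
      · rw [canonicalWord_cons n (_, _) (_ :: _), block_self]
        exact .refl
      · intro b hb
        rcases List.mem_cons.1 hb with rfl | hb
        · simp
        · exact ⟨Or.inr ⟨b, hb, rfl⟩, Or.inr ⟨b, hb, rfl⟩⟩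
    rcases lt_trichotomy i (c + 1) with hic | hic | hic
    -- The letter recurs inside the block, just after its lower neighbour `d`. Sliding it past the
    -- letters before `d` produces `c d c`.
    · exfalso
      obtain ⟨d, hd⟩ : ∃ d : Fin n, (d : ℕ) + 1 = c := ⟨⟨c - 1, by omega⟩, by simp; omega⟩
      have e : block n i j = block n i d ++ d :: c :: block n (c + 2) j := by
        rw [← block_append (k := d) (j := j) (by omega) (by omega), block_cons d (by omega),
          show (d : ℕ) + 2 = c + 1 by omega, block_cons c (by omega)]
      rw [canonicalWord_cons, e] at hgood
      refine hgood (block n i d ++ [c, d, c] ++ (block n (c + 2) j ++ canonicalWord n L)) ?_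
        (Or.inr ⟨_, _, c, d, Or.inr hd, rfl⟩)
      have := commEquiv_cons_append (M := CoxeterMatrix.A n) (c := c) (u := block n i d)
        (d :: c :: block n (c + 2) j ++ canonicalWord n L) (by
          intro x hx
          rw [mem_block] at hx
          rw [coxeterMatrix_A_eq_two]
          omega)
      simpa using this
    · exfalso
      subst hic
      rw [canonicalWord_cons, block_cons c hjc] at hgood
      exact hgood _ .refl (Or.inl ⟨[], block n (c + 2) j ++ canonicalWord n L, c, by simp⟩)
    -- The letter is $\sigma_{c+1}$: if $i>c+2$ it commutes with the whole block, and if $i=c+2$ it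
    -- extends the block.
    rcases Nat.lt_or_ge (c + 2) i with hi2 | hi2
    · obtain ⟨L', hstd', hcomm, hmem⟩ := exists_canonicalWord_commEquiv_cons c hstd (by
        have h1 : CommEquiv (CoxeterMatrix.A n) (c :: canonicalWord n ((i, j) :: L))
            (block n i j ++ c :: canonicalWord n L) := by
          rw [canonicalWord_cons]
          refine commEquiv_cons_append _ ?_
          intro x hx
          rw [mem_block] at hx
          rw [coxeterMatrix_A_eq_two]
          omega
        intro v' hv' hs
        refine hgood _ (h1.trans ?_) (hs.append (block n i j) [])
        simpa using hv'.append (block n i j) [])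
      refine ⟨(i, j) :: L', ?_, ?_, ?_⟩
      · rw [isStandard_cons]
        refine ⟨⟨h1i, hij, hjn⟩, ?_, hstd'⟩
        intro b hb
        obtain ⟨h1, h2⟩ := hmem b hb
        constructor
        · rcases h1 with h1 | ⟨a, ha, h1⟩
          · dsimp only; omega
          · rw [h1]; exact (hlt a ha).1
        · rcases h2 with h1 | ⟨a, ha, h1⟩
          · dsimp only; omega
          · rw [h1]; exact (hlt a ha).2
      · rw [canonicalWord_cons, canonicalWord_cons]
        refine (commEquiv_cons_append (u := block n i j) _ ?_).trans ?_
        · intro x hx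
          rw [mem_block] at hx
          rw [coxeterMatrix_A_eq_two]
          omega
        · simpa using hcomm.append (block n i j) []
      · intro b hb
        rcases List.mem_cons.1 hb with rfl | hb
        · simp
        · obtain ⟨h1, h2⟩ := hmem b hb
          refine ⟨h1.imp_right ?_, h2.imp_right ?_⟩ <;>
          · rintro ⟨a, ha, h⟩
            exact ⟨a, List.mem_cons_of_mem _ ha, h⟩
    · obtain rfl : i = c + 2 := by omega
      -- Otherwise the next block also starts with `c`; that copy slides left through the first
      -- block as far as `d`, giving `c d c`.
      have hnot : ∀ b ∈ L, b.1 < c + 1 := by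
        intro b hb
        have hb1 := (hlt b hb).1
        by_contra hcon
        rcases L with _ | ⟨⟨i', j'⟩, L⟩
        · simp at hb
        have hi' : i' = c + 1 := by
          have := (hlt (i', j') (by simp)).1
          rcases List.mem_cons.1 hb with rfl | hb'
          · dsimp only at *; omega
          · have := ((isStandard_cons.1 hstd).2.1 b hb').1
            dsimp only at *; omega
        subst hi'
        have hj' : (c : ℕ) + 1 ≤ j' := (isStandard_cons.1 hstd).1.2.1
        obtain ⟨d, hd⟩ : ∃ d : Fin n, (d : ℕ) = c + 1 := ⟨⟨c + 1, by omega⟩, rfl⟩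
        have e : block n (c + 2) j = d :: block n (c + 3) j := by
          have := block_cons (j := j) d (by omega)
          rwa [hd] at this
        rw [canonicalWord_cons, canonicalWord_cons, e, block_cons c hj'] at hgood
        refine hgood ([] ++ [c, d, c] ++ (block n (c + 3) j ++ (block n (c + 2) j' ++
          canonicalWord n L))) ?_ (Or.inr ⟨_, _, c, d, Or.inl hd.symm, rfl⟩)
        have := commEquiv_cons_append (M := CoxeterMatrix.A n) (c := c) (u := block n (c + 3) j)
          (block n (c + 2) j' ++ canonicalWord n L) (by
            intro x hx
            rw [mem_block] at hx
            rw [coxeterMatrix_A_eq_two]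
            omega)
        simpa using this.symm.append [c, d] []
      refine ⟨(c + 1, j) :: L, ?_, ?_, ?_⟩
      · rw [isStandard_cons]
        exact ⟨⟨by simp, hjc, hjn⟩, fun b hb => ⟨hnot b hb, (hlt b hb).2⟩, hstd⟩
      · rw [canonicalWord_cons, canonicalWord_cons, block_cons c hjc]
        exact .refl
      · intro b hb
        rcases List.mem_cons.1 hb with rfl | hb
        · exact ⟨Or.inl rfl, Or.inr ⟨_, List.mem_cons_self, rfl⟩⟩
        · exact ⟨Or.inr ⟨b, List.mem_cons_of_mem _ hb, rfl⟩,
            Or.inr ⟨b, List.mem_cons_of_mem _ hb, rfl⟩⟩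

theorem exists_canonicalWord_commEquiv {n : ℕ} : ∀ {v : List (Fin n)}, NoShortening v →
    ∃ L, IsStandard n L ∧ CommEquiv (CoxeterMatrix.A n) v (canonicalWord n L)
  | [], _ => ⟨[], isStandard_nil, .refl⟩
  | c :: v, h => by
    obtain ⟨L, hL, hv⟩ := exists_canonicalWord_commEquiv h.of_cons
    obtain ⟨L', hL', hc, -⟩ :=
      exists_canonicalWord_commEquiv_cons c hL (h.of_commEquiv (hv.cons c))
    exact ⟨L', hL', (hv.cons c).trans hc⟩

/-! ### The action by permutations of `ℕ` -/

/-- The permutation of `ℕ` given by a word, the leftmost letter acting first. -/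
def act {n : ℕ} : List (Fin n) → ℕ → ℕ
  | [], x => x
  | c :: v, x => act v (Equiv.swap (c : ℕ) (c + 1) x)

theorem act_append {n : ℕ} : ∀ (u v : List (Fin n)) (x : ℕ), act (u ++ v) x = act v (act u x)
  | [], _, _ => rfl
  | c :: u, v, x => act_append u v (Equiv.swap (c : ℕ) (c + 1) x)

theorem act_injective {n : ℕ} : ∀ v : List (Fin n), Function.Injective (act v)
  | [] => fun _ _ h => h
  | _ :: v => fun _ _ h => (Equiv.swap _ _).injective (act_injective v h)

theorem swap_liftable (n : ℕ) :
    (CoxeterMatrix.A n).IsLiftable fun k : Fin n => Equiv.swap (k : ℕ) (k + 1) := by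
  have key : ∀ a : ℕ, (Equiv.swap a (a + 1) * Equiv.swap (a + 1) (a + 2)) ^ 3 = 1 := by
    intro a
    have h : Equiv.swap a (a + 1) * Equiv.swap (a + 1) (a + 2) * Equiv.swap a (a + 1) =
        Equiv.swap (a + 1) (a + 2) * Equiv.swap a (a + 1) * Equiv.swap (a + 1) (a + 2) := by
      ext x
      simp only [Equiv.Perm.mul_apply, Equiv.swap_apply_def]
      grind
    calc (Equiv.swap a (a + 1) * Equiv.swap (a + 1) (a + 2)) ^ 3
        = (Equiv.swap a (a + 1) * Equiv.swap (a + 1) (a + 2) * Equiv.swap a (a + 1)) *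
          (Equiv.swap (a + 1) (a + 2) * Equiv.swap a (a + 1) * Equiv.swap (a + 1) (a + 2)) := by
          simp only [pow_succ, pow_zero, one_mul, mul_assoc]
      _ = 1 := by
          rw [← h]
          simp only [mul_assoc, ← mul_assoc (Equiv.swap a (a + 1)) (Equiv.swap a (a + 1)),
            ← mul_assoc (Equiv.swap (a + 1) (a + 2)) (Equiv.swap (a + 1) (a + 2)),
            Equiv.swap_mul_self, one_mul]
  intro i j
  rcases lt_trichotomy (i : ℕ) j with h | h | h
  · rcases Nat.lt_or_ge ((i : ℕ) + 1) j with h2 | h2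
    · rw [coxeterMatrix_A_eq_two.2 (Or.inl h2)]
      ext x
      simp only [pow_two, Equiv.Perm.mul_apply, Equiv.swap_apply_def, Equiv.Perm.one_apply]
      grind
    · have h3 : (j : ℕ) = i + 1 := by omega
      rw [coxeterMatrix_A_of_succ h3.symm]
      simpa only [h3] using key i
  · obtain rfl := Fin.ext h
    simp
  · rcases Nat.lt_or_ge ((j : ℕ) + 1) i with h2 | h2
    · rw [coxeterMatrix_A_eq_two.2 (Or.inr h2)]
      ext x
      simp only [pow_two, Equiv.Perm.mul_apply, Equiv.swap_apply_def, Equiv.Perm.one_apply]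
      grind
    · have h3 : (i : ℕ) = j + 1 := by omega
      rw [(CoxeterMatrix.A n).symmetric, coxeterMatrix_A_of_succ h3.symm]
      have := congrArg (fun g => g⁻¹) (key j)
      simpa only [h3, ← inv_pow, mul_inv_rev, Equiv.swap_inv, inv_one] using this

section System

variable {W : Type*} [Group W] {n : ℕ} (cs : CoxeterSystem (CoxeterMatrix.A n) W)

/-- The inverse appears because letters act from left to right while permutations compose from right
to left. -/
theorem act_eq_lift (v : List (Fin n)) (x : ℕ) :
    act v x = (cs.lift ⟨_, swap_liftable n⟩ (cs.wordProd v))⁻¹ x := by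
  induction v generalizing x with
  | nil => simp [act]
  | cons c v ih =>
    rw [cs.wordProd_cons, map_mul, mul_inv_rev, Equiv.Perm.mul_apply, cs.lift_apply_simple,
      Equiv.swap_inv, act, ih]

theorem act_eq_of_wordProd_eq {u v : List (Fin n)} (h : cs.wordProd u = cs.wordProd v) :
    act u = act v := by
  ext x
  rw [act_eq_lift cs, act_eq_lift cs, h]

/-! ### Reflections and the exchange property -/

theorem simple_comm {s t : Fin n} (h : (s : ℕ) + 1 < t ∨ (t : ℕ) + 1 < s) :
    cs.simple s * cs.simple t = cs.simple t * cs.simple s := by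
  have h1 := cs.simple_mul_simple_pow s t
  rw [coxeterMatrix_A_eq_two.2 h, pow_two] at h1
  have h2 := eq_inv_of_mul_eq_one_left h1
  simpa using h2

theorem simple_braid {s t : Fin n} (h : (s : ℕ) + 1 = t) :
    cs.simple s * cs.simple t * cs.simple s = cs.simple t * cs.simple s * cs.simple t := by
  have h1 := cs.simple_mul_simple_pow s t
  rw [coxeterMatrix_A_of_succ h] at h1
  have h2 : (cs.simple s * cs.simple t * cs.simple s) *
      (cs.simple t * cs.simple s * cs.simple t) = 1 := by
    rw [← h1]; simp only [pow_succ, pow_zero, one_mul, mul_assoc]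
  have h3 := eq_inv_of_mul_eq_one_left h2
  simpa [mul_assoc] using h3

/-- The simple reflection with index `k`, or `1` if there is none. -/
def gen (k : ℕ) : W := if h : k < n then cs.simple ⟨k, h⟩ else 1

theorem gen_val (c : Fin n) : gen cs c = cs.simple c := by simp [gen]

theorem gen_mul_self (k : ℕ) : gen cs k * gen cs k = 1 := by
  unfold gen; split_ifs <;> simp

theorem gen_mul_cancel (k : ℕ) (w : W) : gen cs k * (gen cs k * w) = w := by
  rw [← mul_assoc, gen_mul_self, one_mul]

theorem gen_comm {k l : ℕ} (h : k + 1 < l) : gen cs k * gen cs l = gen cs l * gen cs k := by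
  unfold gen
  split_ifs
  · exact simple_comm cs (Or.inl h)
  all_goals simp

theorem gen_braid {k : ℕ} (h : k + 1 < n) :
    gen cs k * gen cs (k + 1) * gen cs k = gen cs (k + 1) * gen cs k * gen cs (k + 1) := by
  unfold gen
  rw [dif_pos (by omega), dif_pos h]
  exact simple_braid cs rfl

/-- The reflection exchanging `a` and `a + d + 1`. -/
def reflection (a : ℕ) : ℕ → W
  | 0 => gen cs a
  | d + 1 => gen cs (a + d + 1) * reflection a d * gen cs (a + d + 1)

theorem gen_mul_reflection_of_lt {c a d : ℕ} (h : c + 1 < a) :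
    gen cs c * reflection cs a d = reflection cs a d * gen cs c := by
  induction d with
  | zero => exact gen_comm cs h
  | succ d ih =>
    have h1 := gen_comm cs (k := c) (l := a + d + 1) (by omega)
    simp only [reflection]
    rw [← mul_assoc, ← mul_assoc, h1, mul_assoc _ (gen cs c), ih, mul_assoc, mul_assoc, h1]
    simp only [mul_assoc]

theorem gen_mul_reflection_of_gt {c a d : ℕ} (h : a + d + 1 < c) :
    gen cs c * reflection cs a d = reflection cs a d * gen cs c := by
  induction d with
  | zero => exact (gen_comm cs h).symm
  | succ d ih =>
    have h1 := gen_comm cs (k := a + d + 1) (l := c) (by omega)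
    simp only [reflection]
    rw [← mul_assoc, ← mul_assoc, ← h1, mul_assoc _ (gen cs c), ih (by omega), mul_assoc,
      mul_assoc, ← h1]
    simp only [mul_assoc]

theorem gen_mul_reflection_succ {c d : ℕ} (h : c + 1 + d < n) :
    gen cs c * reflection cs (c + 1) d = reflection cs c (d + 1) * gen cs c := by
  induction d with
  | zero =>
    simp only [reflection, add_zero]
    rw [← gen_braid cs h, mul_assoc, gen_mul_self, mul_one]
  | succ d ih =>
    have h1 := gen_comm cs (k := c) (l := c + 1 + d + 1) (by omega)
    rw [reflection, reflection, show c + (d + 1) + 1 = c + 1 + d + 1 by omega, ← mul_assoc, ← mul_assoc, h1,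
      mul_assoc _ (gen cs c), ih (by omega), mul_assoc, mul_assoc, h1]
    simp only [mul_assoc]

theorem gen_mul_reflection_of_between {c a d : ℕ} (h1 : a < c) (h2 : c < a + d) (h3 : a + d < n) :
    gen cs c * reflection cs a d = reflection cs a d * gen cs c := by
  induction d with
  | zero => omega
  | succ d ih =>
    rcases Nat.lt_or_ge c (a + d) with h | h
    · have h4 := gen_comm cs (k := c) (l := a + d + 1) (by omega)
      simp only [reflection]
      rw [← mul_assoc, ← mul_assoc, h4, mul_assoc _ (gen cs c), ih h (by omega), mul_assoc,
        mul_assoc, h4]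
      simp only [mul_assoc]
    · obtain rfl : c = a + d := by omega
      obtain ⟨e, rfl⟩ : ∃ e, d = e + 1 := ⟨d - 1, by omega⟩
      -- The reflection is $yxrxy$; the braid relation on either side of the commutation of $y$ with
      -- $r$ carries $x$ across.
      have hb := gen_braid cs (k := a + (e + 1)) (by omega)
      have hc := gen_mul_reflection_of_gt cs (c := a + (e + 1) + 1) (a := a) (d := e) (by omega)
      simp only [reflection]
      rw [show a + e + 1 = a + (e + 1) by omega]
      set x := gen cs (a + (e + 1))
      set y := gen cs (a + (e + 1) + 1)
      set r := reflection cs a e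
      calc x * (y * (x * r * x) * y) = (x * y * x) * r * (x * y) := by simp only [mul_assoc]
        _ = y * x * (y * r) * (x * y) := by rw [hb]; simp only [mul_assoc]
        _ = y * x * r * (y * x * y) := by rw [hc]; simp only [mul_assoc]
        _ = _ := by rw [← hb]; simp only [mul_assoc]

/-- Conjugation of a reflection by a simple reflection, together with the effect on positions. -/
theorem exists_reflection_mul_gen {a d c : ℕ} (hc : c < n) (had : a + d < n)
    (hne : ¬ (a = c ∧ d = 0)) :
    ∃ a' d', a' + d' < n ∧ reflection cs a d * gen cs c = gen cs c * reflection cs a' d' ∧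
      a' = Equiv.swap c (c + 1) a ∧ a' + d' + 1 = Equiv.swap c (c + 1) (a + d + 1) := by
  simp only [Equiv.swap_apply_def]
  by_cases h1 : c + 1 < a
  · refine ⟨a, d, had, (gen_mul_reflection_of_lt cs h1).symm, ?_, ?_⟩ <;> split_ifs <;> omega
  by_cases h2 : a + d + 1 < c
  · refine ⟨a, d, had, (gen_mul_reflection_of_gt cs h2).symm, ?_, ?_⟩ <;> split_ifs <;> omega
  by_cases h3 : c + 1 = a
  · subst h3
    refine ⟨c, d + 1, by omega, ?_, ?_, ?_⟩
    · have := congrArg (fun w => gen cs c * w * gen cs c) (gen_mul_reflection_succ cs had)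
      simpa [mul_assoc, gen_mul_self, gen_mul_cancel] using this
    all_goals split_ifs <;> omega
  by_cases h4 : c = a + d + 1
  · subst h4
    refine ⟨a, d + 1, by omega, ?_, ?_, ?_⟩
    · rw [reflection, mul_assoc, gen_mul_cancel]
    all_goals split_ifs <;> omega
  by_cases h5 : c = a
  · subst h5
    obtain ⟨e, rfl⟩ : ∃ e, d = e + 1 := ⟨d - 1, by omega⟩
    refine ⟨c + 1, e, by omega, (gen_mul_reflection_succ cs (by omega)).symm, ?_, ?_⟩ <;>
      split_ifs <;> omega
  by_cases h6 : c = a + d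
  · subst h6
    obtain ⟨e, rfl⟩ : ∃ e, d = e + 1 := ⟨d - 1, by omega⟩
    refine ⟨a, e, by omega, ?_, ?_, ?_⟩
    · rw [reflection, show a + (e + 1) = a + e + 1 by omega, mul_assoc, gen_mul_self, mul_one]
    all_goals split_ifs <;> omega
  · refine ⟨a, d, had, (gen_mul_reflection_of_between cs (by omega) (by omega) had).symm, ?_, ?_⟩ <;>
      split_ifs <;> omega

/-- Exchange property: follow the inverted pair of positions through the word. Some letter must swap
exactly this pair, and multiplying by the reflection deletes that letter. -/
theorem exists_shorter_reflection_mul (v : List (Fin n)) : ∀ {a d : ℕ}, a + d < n →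
    act v (a + d + 1) < act v a →
    ∃ v' : List (Fin n), v'.length < v.length ∧ reflection cs a d * cs.wordProd v = cs.wordProd v' := by
  induction v with
  | nil => intro a d _ h; simp only [act] at h; omega
  | cons c v ih =>
    intro a d had h
    by_cases hne : a = c ∧ d = 0
    · obtain ⟨rfl, rfl⟩ := hne
      exact ⟨v, by simp, by rw [reflection, gen_val, cs.wordProd_cons, cs.simple_mul_simple_cancel_left]⟩
    · obtain ⟨a', d', h1, h2, h3, h4⟩ := exists_reflection_mul_gen cs c.2 had hne
      rw [act, act, ← h3, ← h4] at h
      obtain ⟨v', hlen, hv'⟩ := ih h1 h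
      refine ⟨c :: v', by simpa using hlen, ?_⟩
      rw [cs.wordProd_cons, cs.wordProd_cons, ← gen_val, ← mul_assoc, h2, mul_assoc, hv']

theorem isReduced_of_cons {c : Fin n} {v : List (Fin n)} (h : cs.IsReduced (c :: v)) :
    cs.IsReduced v := by
  simpa using h.drop 1

/-- A descent at `c` would let the exchange property write the product of `c :: v` with fewer
letters than `v`. -/
theorem act_lt_of_isReduced_cons {c : Fin n} {v : List (Fin n)} (h : cs.IsReduced (c :: v)) :
    act v c < act v (c + 1) := by
  refine lt_of_le_of_ne (le_of_not_gt fun hlt => ?_) fun heq => ?_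
  · obtain ⟨v', hlen, hv'⟩ := exists_shorter_reflection_mul cs v (a := c) (d := 0) c.2 hlt
    have h1 := h.eq
    rw [cs.wordProd_cons, ← gen_val] at h1
    simp only [reflection] at hv'
    rw [hv', List.length_cons] at h1
    have := cs.length_wordProd_le v'
    omega
  · have := act_injective v heq
    omega

/-! ### Pattern avoidance -/

/-- The function has no decreasing subsequence of length three. -/
def Avoids321 (f : ℕ → ℕ) : Prop := ∀ x y z, x < y → y < z → ¬ (f z < f y ∧ f y < f x)

/-- Since `v` has an ascent at `c`, no decreasing pair sits at `c`, `c + 1`. The swap therefore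
keeps the order of every decreasing pair and carries a pattern over. -/
theorem Avoids321.of_cons {c : Fin n} {v : List (Fin n)} (h : cs.IsReduced (c :: v))
    (hav : Avoids321 (act (c :: v))) : Avoids321 (act v) := by
  have hlt := act_lt_of_isReduced_cons cs h
  intro x y z hxy hyz hpat
  have hne : ∀ p q : ℕ, p < q → act v q < act v p → Equiv.swap (c : ℕ) (c + 1) p <
      Equiv.swap (c : ℕ) (c + 1) q := by
    intro p q hpq hlt'
    have : ¬ (p = c ∧ q = c + 1) := by rintro ⟨rfl, rfl⟩; omega
    simp only [Equiv.swap_apply_def]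
    split_ifs <;> omega
  refine hav _ _ _ (hne x y hxy hpat.2) (hne y z hyz hpat.1) ?_
  simpa [act] using hpat

theorem Avoids321.of_append {u v : List (Fin n)} (h : cs.IsReduced (u ++ v))
    (hav : Avoids321 (act (u ++ v))) : cs.IsReduced v ∧ Avoids321 (act v) := by
  induction u with
  | nil => exact ⟨h, hav⟩
  | cons c u ih => exact ih (isReduced_of_cons cs h) (hav.of_cons cs h)

/-- After stripping the prefix, `s s` would demand both an ascent and a descent at `s`. For `s t s`,
reducedness makes the remaining suffix increasing on three consecutive points, which `s t s` then
reverses into a 321 pattern. -/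
theorem not_hasShortening {v : List (Fin n)} (h : cs.IsReduced v) (hav : Avoids321 (act v)) :
    ¬ HasShortening v := by
  rintro (⟨a, b, s, rfl⟩ | ⟨a, b, s, t, hst, rfl⟩)
  · rw [List.append_assoc] at h hav
    obtain ⟨h1, -⟩ := hav.of_append cs h
    have e1 := act_lt_of_isReduced_cons cs h1
    have e2 := act_lt_of_isReduced_cons cs (isReduced_of_cons cs h1)
    simp [act] at e1 e2
    omega
  · rw [List.append_assoc] at h hav
    obtain ⟨h1, hav1⟩ := hav.of_append cs h
    have h2 := isReduced_of_cons cs h1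
    have e1 := act_lt_of_isReduced_cons cs h1
    have e2 := act_lt_of_isReduced_cons cs h2
    have e3 := act_lt_of_isReduced_cons cs (isReduced_of_cons cs h2)
    rcases hst with hst | hst
    · have := hav1 s (s + 1) (s + 2) (by omega) (by omega)
      have n1 : ¬ (s : ℕ) = s + 1 + 1 := by omega
      have n2 : ¬ (s : ℕ) + 1 + 1 = s := by omega
      simp [act, Equiv.swap_apply_def, ← hst, n1, n2] at e1 e2 e3 this
      omega
    · have := hav1 t (t + 1) (t + 2) (by omega) (by omega)
      have n1 : ¬ (t : ℕ) = t + 1 + 1 := by omega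
      have n2 : ¬ (t : ℕ) + 1 + 1 = t := by omega
      simp [act, Equiv.swap_apply_def, ← hst, n1, n2] at e1 e2 e3 this
      omega

theorem CommEquiv.wordProd_eq {u v : List (Fin n)} (h : CommEquiv (CoxeterMatrix.A n) u v) :
    cs.wordProd u = cs.wordProd v := by
  induction h with
  | refl => rfl
  | tail _ h ih =>
    obtain ⟨a, b, s, t, hst, rfl, rfl⟩ := h
    rw [ih]
    simp only [cs.wordProd_append, cs.wordProd_cons, cs.wordProd_nil, mul_one]
    rw [simple_comm cs (coxeterMatrix_A_eq_two.1 hst)]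

theorem CommEquiv.length_eq {u v : List (Fin n)} (h : CommEquiv (CoxeterMatrix.A n) u v) :
    u.length = v.length := by
  induction h with
  | refl => rfl
  | tail _ h ih =>
    obtain ⟨a, b, s, t, hst, rfl, rfl⟩ := h
    simpa using ih

theorem noShortening_of_isReduced {v : List (Fin n)} (h : cs.IsReduced v)
    (hav : Avoids321 (act v)) : NoShortening v := by
  intro v' hv'
  have hp := hv'.wordProd_eq cs
  refine not_hasShortening cs ?_ (by rwa [← act_eq_of_wordProd_eq cs hp])
  rw [CoxeterSystem.IsReduced, ← hp, ← hv'.length_eq]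
  exact h

end System

/-! ### The permutation of a canonical word -/

theorem act_block {n i j : ℕ} (hi : 1 ≤ i) (hij : i ≤ j + 1) (hj : j ≤ n) (x : ℕ) :
    act (block n i j) x =
      if x + 1 = i then j else if i ≤ x ∧ x ≤ j then x - 1 else x := by
  obtain ⟨d, hd⟩ : ∃ d, j + 1 = i + d := ⟨j + 1 - i, by omega⟩
  induction d generalizing i x with
  | zero =>
    rw [block_eq_nil (by omega)]
    simp only [act]
    split_ifs <;> omega
  | succ d ih =>
    obtain ⟨c, rfl⟩ : ∃ c : Fin n, (c : ℕ) + 1 = i := ⟨⟨i - 1, by omega⟩, by simp; omega⟩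
    rw [block_cons c (by omega), act, ih (by omega) (by omega) _ (by omega)]
    simp only [Equiv.swap_apply_def]
    split_ifs <;> omega

theorem act_canonicalWord_of_gt {n : ℕ} {L : List (ℕ × ℕ)} (hL : IsStandard n L) {x : ℕ}
    (hx : ∀ a ∈ L, a.2 < x) : act (canonicalWord n L) x = x := by
  induction L with
  | nil => rfl
  | cons a L ih =>
    obtain ⟨⟨h1, h2, h3⟩, h4, h5⟩ := isStandard_cons.1 hL
    have hxa := hx a (by simp)
    have hxj : ¬ x ≤ a.2 := by omega
    rw [canonicalWord_cons, act_append, act_block h1 (by omega) h3, if_neg (by omega),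
      if_neg (by omega)]
    exact ih h5 fun b hb => hx b (by simp [hb])

/-- Earlier blocks start too high to touch $i-1$; later blocks end below $j$ and fix it. -/
theorem act_canonicalWord_of_mem {n : ℕ} {L : List (ℕ × ℕ)} (hL : IsStandard n L) {i j : ℕ}
    (h : (i, j) ∈ L) : act (canonicalWord n L) (i - 1) = j := by
  induction L with
  | nil => simp at h
  | cons a L ih =>
    obtain ⟨⟨h1, h2, h3⟩, h4, h5⟩ := isStandard_cons.1 hL
    rw [canonicalWord_cons, act_append, act_block h1 (by omega) h3]
    rcases List.mem_cons.1 h with rfl | h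
    · rw [if_pos (by dsimp only at *; omega)]
      exact act_canonicalWord_of_gt h5 fun b hb => (h4 b hb).2
    · have := h4 _ h
      have h6 := h5.1 _ h
      dsimp only at this h6
      rw [if_neg (by omega), if_neg (by omega)]
      exact ih h5 h

theorem act_canonicalWord_of_not_mem {n : ℕ} {L : List (ℕ × ℕ)} (hL : IsStandard n L) {x : ℕ}
    (hx : ∀ a ∈ L, x + 1 ≠ a.1) : act (canonicalWord n L) x ≤ x ∧
      ∀ y, x < y → (∀ a ∈ L, y + 1 ≠ a.1) →
        act (canonicalWord n L) x < act (canonicalWord n L) y := by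
  induction L generalizing x with
  | nil => exact ⟨le_rfl, fun y hy _ => hy⟩
  | cons a L ih =>
    obtain ⟨⟨h1, h2, h3⟩, h4, h5⟩ := isStandard_cons.1 hL
    have key : ∀ z, (∀ b ∈ a :: L, z + 1 ≠ b.1) → ∃ z',
        act (canonicalWord n (a :: L)) z = act (canonicalWord n L) z' ∧ z' ≤ z ∧
        (∀ b ∈ L, z' + 1 ≠ b.1) ∧ z' = if a.1 ≤ z ∧ z ≤ a.2 then z - 1 else z := by
      intro z hz
      have hza := hz a (by simp)
      refine ⟨_, ?_, ?_, ?_, rfl⟩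
      · rw [canonicalWord_cons, act_append, act_block h1 (by omega) h3, if_neg hza]
      · split_ifs <;> omega
      -- A point lowered by the first block had $z\ge a_1$, which exceeds every remaining start.
      · intro b hb
        have := h4 b hb
        have := hz b (by simp [hb])
        split_ifs <;> omega
    obtain ⟨x', e1, e2, e3, e4⟩ := key x hx
    have hih := ih h5 e3
    refine ⟨by rw [e1]; exact hih.1.trans e2, ?_⟩
    intro y hxy hy
    obtain ⟨y', f1, f2, f3, f4⟩ := key y hy
    rw [e1, f1]
    refine hih.2 y' ?_ f3
    have := hx a (by simp)
    rw [e4, f4]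
    split_ifs <;> omega

theorem isStandard_pair_lt {n : ℕ} {L : List (ℕ × ℕ)} (hL : IsStandard n L) {a b : ℕ × ℕ}
    (ha : a ∈ L) (hb : b ∈ L) (h : a.1 < b.1) : a.2 < b.2 := by
  induction L with
  | nil => simp at ha
  | cons c L ih =>
    obtain ⟨-, h4, h5⟩ := isStandard_cons.1 hL
    rcases List.mem_cons.1 ha with rfl | ha' <;> rcases List.mem_cons.1 hb with rfl | hb'
    · omega
    · have := h4 b hb'; omega
    · exact (h4 _ ha').2
    · exact ih h5 ha' hb'

/-- The permutation increases on the block starts and on their complement, and two of any three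
points fall in the same class. -/
theorem avoids321_act_canonicalWord {n : ℕ} {L : List (ℕ × ℕ)} (hL : IsStandard n L) :
    Avoids321 (act (canonicalWord n L)) := by
  have hE : ∀ x y, (∃ a ∈ L, x + 1 = a.1) → (∃ a ∈ L, y + 1 = a.1) → x < y →
      act (canonicalWord n L) x < act (canonicalWord n L) y := by
    rintro x y ⟨a, ha, hxa⟩ ⟨b, hb, hyb⟩ hxy
    obtain rfl : x = a.1 - 1 := by omega
    obtain rfl : y = b.1 - 1 := by omega
    rw [act_canonicalWord_of_mem hL ha, act_canonicalWord_of_mem hL hb]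
    exact isStandard_pair_lt hL ha hb (by omega)
  have hN : ∀ x y, ¬ (∃ a ∈ L, x + 1 = a.1) → ¬ (∃ a ∈ L, y + 1 = a.1) → x < y →
      act (canonicalWord n L) x < act (canonicalWord n L) y := by
    intro x y hx hy hxy
    push Not at hx hy
    exact (act_canonicalWord_of_not_mem hL hx).2 y hxy hy
  rintro x y z hxy hyz ⟨h1, h2⟩
  by_cases hx : ∃ a ∈ L, x + 1 = a.1 <;> by_cases hy : ∃ a ∈ L, y + 1 = a.1 <;>
    by_cases hz : ∃ a ∈ L, z + 1 = a.1
  · exact absurd (hE _ _ hx hy hxy) (by omega)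
  · exact absurd (hE _ _ hx hy hxy) (by omega)
  · exact absurd (hE _ _ hx hz (hxy.trans hyz)) (by omega)
  · exact absurd (hN _ _ hy hz hyz) (by omega)
  · exact absurd (hE _ _ hy hz hyz) (by omega)
  · exact absurd (hN _ _ hx hz (hxy.trans hyz)) (by omega)
  · exact absurd (hN _ _ hx hy hxy) (by omega)
  · exact absurd (hN _ _ hx hy hxy) (by omega)

/-- The pairs are read off from the excedances, and the strict order on them fixes the list. -/
theorem isStandard_eq_of_act_eq {n : ℕ} {L L' : List (ℕ × ℕ)} (hL : IsStandard n L)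
    (hL' : IsStandard n L') (h : act (canonicalWord n L) = act (canonicalWord n L')) : L = L' := by
  have key : ∀ {K K' : List (ℕ × ℕ)}, IsStandard n K → IsStandard n K' →
      act (canonicalWord n K) = act (canonicalWord n K') → ∀ a ∈ K, a ∈ K' := by
    rintro K K' hK hK' h ⟨i, j⟩ ha
    have h1 := act_canonicalWord_of_mem hK ha
    have h2 := hK.1 _ ha
    dsimp only at h2
    by_contra hcon
    have h3 := (act_canonicalWord_of_not_mem hK' (x := i - 1) ?_).1
    · rw [← h, h1] at h3
      omega
    · rintro ⟨i', j'⟩ hb hib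
      obtain rfl : i = i' := by dsimp only at hib; omega
      have h4 := act_canonicalWord_of_mem hK' hb
      rw [← h, h1] at h4
      exact hcon (h4 ▸ hb)
  have : Std.Irrefl fun a b : ℕ × ℕ => b.1 < a.1 ∧ b.2 < a.2 := ⟨fun a h => lt_irrefl _ h.1⟩
  have : Std.Antisymm fun a b : ℕ × ℕ => b.1 < a.1 ∧ b.2 < a.2 :=
    ⟨fun a b h1 h2 => absurd h1.1 (lt_asymm h2.1)⟩
  exact hL.2.eq_of_mem_iff hL'.2 fun a => ⟨key hL hL' h a, key hL' hL h.symm a⟩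

/-! ### Fully commutative elements and canonical forms -/

variable {W : Type*} [Group W] {n : ℕ} (cs : CoxeterSystem (CoxeterMatrix.A n) W)

theorem isFC_of_isStandard {L : List (ℕ × ℕ)} (hL : IsStandard n L) :
    IsFC cs (cs.wordProd (canonicalWord n L)) := by
  have key : ∀ v, cs.IsReduced v → cs.wordProd v = cs.wordProd (canonicalWord n L) →
      CommEquiv (CoxeterMatrix.A n) v (canonicalWord n L) := by
    intro v hv hp
    have hact := act_eq_of_wordProd_eq cs hp
    obtain ⟨L', hL', hc⟩ := exists_canonicalWord_commEquiv
      (noShortening_of_isReduced cs hv (hact ▸ avoids321_act_canonicalWord hL))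
    have : L' = L := isStandard_eq_of_act_eq hL' hL
      ((act_eq_of_wordProd_eq cs (hc.wordProd_eq cs)).symm.trans hact)
    exact this ▸ hc
  intro u v hu hv hpu hpv
  exact (key u hu hpu).trans (key v hv hpv).symm

theorem ncard_fcWith (P : List (ℕ × ℕ) → Prop) :
    (fcWith cs P).ncard = {L | IsStandard n L ∧ P L}.ncard := by
  have : fcWith cs P = (fun L => cs.wordProd (canonicalWord n L)) '' {L | IsStandard n L ∧ P L} := by
    ext w
    constructor
    · rintro ⟨-, L, ⟨hL, rfl⟩, hP⟩
      exact ⟨L, ⟨hL, hP⟩, rfl⟩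
    · rintro ⟨L, ⟨hL, hP⟩, rfl⟩
      exact ⟨isFC_of_isStandard cs hL, L, ⟨hL, rfl⟩, hP⟩
  rw [this]
  refine Set.InjOn.ncard_image ?_
  rintro L ⟨hL, -⟩ L' ⟨hL', -⟩ h
  exact isStandard_eq_of_act_eq hL hL' (act_eq_of_wordProd_eq cs h)

/-! ### Counting standard lists by their first block -/

theorem ncard_eq_sum_fiber {α β : Type*} [DecidableEq β] {A : Set α} (hA : A.Finite) (f : α → β)
    (t : Finset β) (h : ∀ a ∈ A, f a ∈ t) : A.ncard = ∑ b ∈ t, {a | a ∈ A ∧ f a = b}.ncard := by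
  rw [Set.ncard_eq_toFinset_card A hA,
    Finset.card_eq_sum_card_fiberwise (f := f) (t := t) (by simpa [Set.MapsTo] using h)]
  refine Finset.sum_congr rfl fun b _ => ?_
  rw [← Set.ncard_coe_finset]
  congr 1
  ext a
  simp

theorem finite_isStandard (n : ℕ) : {L | IsStandard n L}.Finite := by
  have hI : Std.Irrefl fun a b : ℕ × ℕ => b.1 < a.1 ∧ b.2 < a.2 := ⟨fun a h => lt_irrefl _ h.1⟩
  have hA : Std.Antisymm fun a b : ℕ × ℕ => b.1 < a.1 ∧ b.2 < a.2 :=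
    ⟨fun a b h1 h2 => absurd h1.1 (lt_asymm h2.1)⟩
  refine Set.Finite.of_finite_image (f := List.toFinset) ?_ ?_
  · refine (Finset.finite_toSet (Finset.range (n + 1) ×ˢ Finset.range (n + 1)).powerset).subset ?_
    rintro _ ⟨L, hL, rfl⟩
    simp only [Finset.coe_powerset, Set.mem_preimage, Set.mem_powerset_iff]
    intro a ha
    have := hL.1 a (by simpa using ha)
    simp only [Finset.coe_product, Finset.coe_range, Set.mem_prod, Set.mem_Iio]
    omega
  · intro L hL L' hL' h
    refine hL.2.eq_of_mem_iff hL'.2 fun a => ?_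
    rw [← List.mem_toFinset, ← List.mem_toFinset, h]

/-- The number of standard lists with first block `[i, j]` that satisfy `P`. -/
noncomputable def count (n : ℕ) (P : List (ℕ × ℕ) → Prop) (i j : ℕ) : ℕ :=
  {L | IsStandard n L ∧ FirstBlock i j L ∧ P L}.ncard

theorem count_congr {n : ℕ} {P Q : List (ℕ × ℕ) → Prop} {i j : ℕ}
    (h : ∀ L, P ((i, j) :: L) ↔ Q ((i, j) :: L)) : count n P i j = count n Q i j := by
  unfold count
  congr 1
  ext L
  simp only [Set.mem_ofPred_eq, FirstBlock]
  refine and_congr_right fun _ => and_congr_right fun h1 => ?_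
  rcases L with _ | ⟨a, L⟩
  · simp at h1
  · obtain rfl : a = (i, j) := by simpa using h1
    exact h L

theorem count_eq {n i j : ℕ} (P : List (ℕ × ℕ) → Prop) [Decidable (P [(i, j)])]
    (hi : 1 ≤ i) (hij : i ≤ j) (hj : j ≤ n) :
    count n P i j = (if P [(i, j)] then 1 else 0) +
      ∑ i' ∈ Finset.Ico 1 i, ∑ j' ∈ Finset.Ico i' j, count n (fun L => P ((i, j) :: L)) i' j' := by
  set D : Finset (ℕ × ℕ) := (Finset.Ico 1 i ×ˢ Finset.range j).filter fun a => a.1 ≤ a.2 with hD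
  have hmemD : ∀ a : ℕ × ℕ, a ∈ D ↔ a.1 ∈ Finset.Ico 1 i ∧ a.2 ∈ Finset.Ico a.1 j := by
    intro a
    simp only [hD, Finset.mem_filter, Finset.mem_product, Finset.mem_Ico, Finset.mem_range]
    omega
  have hcons : ∀ L, IsStandard n ((i, j) :: L) ↔
      (∀ b ∈ L, b.1 < i ∧ b.2 < j) ∧ IsStandard n L := by
    intro L
    rw [isStandard_cons]
    exact and_iff_right ⟨hi, hij, hj⟩
  have hhead : ∀ L : List (ℕ × ℕ), L.head? = some (i, j) → L = (i, j) :: L.tail := by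
    intro L h
    rcases L with _ | ⟨a, L⟩
    · simp at h
    · simpa using h
  -- The fibres are indexed by the second block; `none` is the list with a single block.
  rw [count, ncard_eq_sum_fiber ((finite_isStandard n).subset fun L hL => hL.1)
    (fun L => L.tail.head?) (Finset.insertNone D), Finset.sum_insertNone]
  · congr 1
    · split_ifs with hP
      · rw [Set.ncard_eq_one]
        refine ⟨[(i, j)], ?_⟩
        ext L
        simp only [Set.mem_ofPred_eq, Set.mem_singleton_iff, FirstBlock, List.head?_eq_none_iff]
        constructor
        · rintro ⟨⟨-, h, -⟩, h2⟩
          rw [hhead L h, h2]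
        · rintro rfl
          exact ⟨⟨(hcons []).2 ⟨by simp, isStandard_nil⟩, rfl, hP⟩, rfl⟩
      · rw [Set.ncard_eq_zero ((finite_isStandard n).subset fun L hL => hL.1.1)]
        ext L
        simp only [Set.mem_ofPred_eq, FirstBlock, List.head?_eq_none_iff, Set.mem_empty_iff_false,
          iff_false]
        rintro ⟨⟨-, h, h1⟩, h2⟩
        rw [hhead L h, h2] at h1
        exact hP h1
    · rw [Finset.sum_finset_product D (Finset.Ico 1 i) (fun i' => Finset.Ico i' j) hmemD]
      refine Finset.sum_congr rfl fun i' hi' => Finset.sum_congr rfl fun j' hj' => ?_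
      rw [Finset.mem_Ico] at hi' hj'
      refine Eq.trans ?_ (Set.ncard_image_of_injective _ (List.cons_injective (a := (i, j))))
      congr 1
      ext L
      simp only [Set.mem_ofPred_eq, FirstBlock, Set.mem_image]
      constructor
      · rintro ⟨⟨h1, h2, h3⟩, h4⟩
        have h5 := hhead L h2
        rw [h5] at h1 h3
        exact ⟨L.tail, ⟨((hcons _).1 h1).2, h4, h3⟩, h5.symm⟩
      · rintro ⟨K, ⟨h1, h2, h3⟩, rfl⟩
        refine ⟨⟨(hcons K).2 ⟨?_, h1⟩, rfl, h3⟩, h2⟩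
        rcases K with _ | ⟨a, K⟩
        · simp
        · obtain rfl : a = (i', j') := by simpa using h2
          intro b hb
          rcases List.mem_cons.1 hb with rfl | hb
          · dsimp only; omega
          · have := (isStandard_cons.1 h1).2.1 b hb
            dsimp only at this; omega
  · rintro L ⟨h1, h2, -⟩
    rw [hhead L h2, hcons] at h1
    rcases hL : L.tail with _ | ⟨a, K⟩
    · simp
    · rw [hL] at h1
      have h3 := h1.1 a (by simp)
      have h4 := h1.2.1 a (by simp)
      simp only [List.head?_cons, Finset.some_mem_insertNone, hmemD, Finset.mem_Ico]
      omega

theorem ncard_startsWith (n : ℕ) (P : List (ℕ × ℕ) → Prop) (i : ℕ) :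
    {L | IsStandard n L ∧ StartsWith i L ∧ P L}.ncard =
      ∑ j ∈ Finset.Ico i (n + 1), count n P i j := by
  rw [ncard_eq_sum_fiber ((finite_isStandard n).subset fun L hL => hL.1)
    (fun L => (L.headD (0, 0)).2) (Finset.Ico i (n + 1))]
  · refine Finset.sum_congr rfl fun j _ => ?_
    unfold count
    congr 1
    ext L
    simp only [Set.mem_ofPred_eq, StartsWith, FirstBlock]
    rcases L with _ | ⟨⟨i', j'⟩, L⟩
    · simp
    · simp only [List.head?_cons, Option.some.injEq, Prod.mk.injEq, List.headD_cons]
      constructor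
      · rintro ⟨⟨h1, ⟨k, h2, h3⟩, h4⟩, h5⟩
        exact ⟨h1, ⟨h2, h5⟩, h4⟩
      · rintro ⟨h1, ⟨h2, h3⟩, h4⟩
        exact ⟨⟨h1, ⟨j', h2, rfl⟩, h4⟩, h3⟩
  · rintro L ⟨h1, ⟨j, h2⟩, -⟩
    rcases L with _ | ⟨a, L⟩
    · simp [FirstBlock] at h2
    · obtain rfl : a = (i, j) := by simpa [FirstBlock] using h2
      have := h1.1 _ List.mem_cons_self
      simp only [List.headD_cons, Finset.mem_Ico] at this ⊢
      omega

/-! ### Closed forms -/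

theorem sum_Ico_eq_sub {f g : ℕ → ℤ} (h : ∀ k, g (k + 1) = g k + f k) {a b : ℕ} (hab : a ≤ b) :
    ∑ k ∈ Finset.Ico a b, f k = g b - g a := by
  rw [← Finset.sum_Ico_sub g hab]
  exact Finset.sum_congr rfl fun k _ => by rw [h]; ring

theorem sum_Ico_one_succ {M : Type*} [AddCommMonoid M] (f : ℕ → M) (a : ℕ) :
    ∑ i ∈ Finset.Ico 1 (a + 1), f i = ∑ i ∈ Finset.Ico 0 a, f (i + 1) := by
  rw [Finset.sum_Ico_add' f 0 a 1, zero_add]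

theorem sum_Ico_succ_succ {M : Type*} [AddCommMonoid M] (f : ℕ → M) (a b : ℕ) :
    ∑ i ∈ Finset.Ico (a + 1) (b + 1), f i = ∑ i ∈ Finset.Ico a b, f (i + 1) := by
  rw [Finset.sum_Ico_add' f a b 1]

/-- Ballot numbers. -/
def ballot (a j : ℕ) : ℤ := (a + j).choose j - (a + j).choose (j + 1)

theorem ballot_succ (a j : ℕ) : ballot (a + 1) (j + 1) = ballot (a + 1) j + ballot a (j + 1) := by
  simp only [ballot, show a + 1 + (j + 1) = (a + 1 + j) + 1 by ring, Nat.choose_succ_succ,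
    show a + (j + 1) = a + 1 + j by ring]
  push_cast
  ring

theorem ballot_zero (j : ℕ) : ballot 0 j = 1 := by simp [ballot]

/-- This kills the lower boundary term of the inner telescoping sum in `count_true`. -/
theorem ballot_succ_self (a : ℕ) : ballot (a + 1) a = 0 := by
  have := Nat.choose_symm_of_eq_add (n := a + 1 + a) (a := a) (b := a + 1) (by ring)
  simp [ballot, this]

/-- Both sums telescope by `ballot_succ`; the single-block list cancels the boundary term `ballot 0
(k + 1)`. -/
theorem count_true {n : ℕ} (a : ℕ) : ∀ j, a + 1 ≤ j → j ≤ n →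
    (count n (fun _ => True) (a + 1) j : ℤ) = ballot a j := by
  induction a using Nat.strong_induction_on with
  | _ a ih =>
  intro j haj hjn
  obtain ⟨k, rfl⟩ : ∃ k, j = k + 1 := ⟨j - 1, by omega⟩
  rw [count_eq _ (by omega) haj hjn, if_pos trivial, sum_Ico_one_succ]
  push_cast
  have h1 : ∀ a' ∈ Finset.Ico 0 a, ∑ j' ∈ Finset.Ico (a' + 1) (k + 1),
      (count n (fun _ => True) (a' + 1) j' : ℤ) = ballot (a' + 1) k := by
    intro a' ha'
    rw [Finset.mem_Ico] at ha'
    rw [Finset.sum_congr rfl (g := fun j' => ballot a' j') fun j' hj' => by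
      rw [Finset.mem_Ico] at hj'
      exact ih a' ha'.2 j' hj'.1 (by omega)]
    rw [sum_Ico_succ_succ, sum_Ico_eq_sub (ballot_succ a') (by omega), ballot_succ_self, sub_zero]
  rw [Finset.sum_congr rfl h1, sum_Ico_eq_sub (g := fun a' => ballot a' (k + 1))
    (fun a' => by rw [ballot_succ, add_comm]) (by omega), ballot_zero]
  ring

/-- The number of standard lists of length `q + 1` with first block `[a + 1, b + 1]`. -/
def narayana : ℕ → ℕ → ℕ → ℤ
  | 0, _, _ => 1
  | q + 1, a, b => a.choose (q + 1) * b.choose (q + 1) - a.choose (q + 2) * b.choose q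

/-- The number of standard lists of length `q + 1` and first block `[a + 1, j]` with `j ≤ b`. -/
def narayanaSum (q a b : ℕ) : ℤ := a.choose q * b.choose (q + 1) - a.choose (q + 1) * b.choose q

theorem narayanaSum_succ (q a b : ℕ) :
    narayanaSum q a (b + 1) = narayanaSum q a b + narayana q a b := by
  cases q with
  | zero => simp [narayanaSum, narayana]; ring
  | succ q =>
    simp only [narayanaSum, narayana, Nat.choose_succ_succ b]
    push_cast
    ring

theorem narayana_succ (q a b : ℕ) :
    narayana (q + 1) (a + 1) b = narayana (q + 1) a b + narayanaSum q a b := by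
  simp only [narayanaSum, narayana, Nat.choose_succ_succ a]
  push_cast
  ring

/-- The lower boundary term vanishes because `narayanaSum q a b` is antisymmetric in `a` and `b`. -/
theorem sum_narayana {q a b : ℕ} (h : a ≤ b) :
    ∑ k ∈ Finset.Ico a b, narayana q a k = narayanaSum q a b := by
  rw [sum_Ico_eq_sub (narayanaSum_succ q a) h]
  simp only [narayanaSum]
  ring

theorem count_length {n : ℕ} (q : ℕ) : ∀ a b, a ≤ b → b + 1 ≤ n →
    (count n (fun L => L.length = q + 1) (a + 1) (b + 1) : ℤ) = narayana q a b := by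
  induction q with
  | zero =>
    intro a b hab hbn
    rw [count_eq _ (by omega) (by omega) hbn, if_pos (by simp), Finset.sum_eq_zero]
    · rfl
    intro i' _
    refine Finset.sum_eq_zero fun j' _ => ?_
    rw [count, Set.ncard_eq_zero ((finite_isStandard n).subset fun L hL => hL.1)]
    ext L
    simp only [FirstBlock, List.length_cons, Set.mem_ofPred_eq, Set.mem_empty_iff_false, iff_false]
    rintro ⟨-, h, h2⟩
    obtain rfl : L = [] := by simpa using h2
    simp at h
  | succ q ih =>
    intro a b hab hbn
    rw [count_eq _ (by omega) (by omega) hbn, if_neg (by simp), sum_Ico_one_succ, zero_add]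
    push_cast
    have h1 : ∀ a' ∈ Finset.Ico 0 a, ∑ j' ∈ Finset.Ico (a' + 1) (b + 1),
        (count n (fun L => ((a + 1, b + 1) :: L).length = q + 1 + 1) (a' + 1) j' : ℤ) =
          narayanaSum q a' b := by
      intro a' ha'
      rw [Finset.mem_Ico] at ha'
      rw [sum_Ico_succ_succ, ← sum_narayana (by omega)]
      refine Finset.sum_congr rfl fun b' hb' => ?_
      rw [Finset.mem_Ico] at hb'
      rw [← ih a' b' hb'.1 (by omega)]
      congr 1
      exact count_congr fun L => by simp
    rw [Finset.sum_congr rfl h1, sum_Ico_eq_sub (g := fun a' => narayana (q + 1) a' b)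
      (fun a' => narayana_succ q a' b) (by omega)]
    simp [narayana]

/-- The number of standard lists with first block `[a + 1, k]` and last block ending in `j`, when
`a ≤ j`. -/
def endCount (j a k : ℕ) : ℤ := if k < j then 0 else Nat.multichoose a (k - j)

/-- The sum of `endCount j a l` over `l < k`. -/
def endCountSum (j a k : ℕ) : ℤ := if k ≤ j then 0 else Nat.multichoose (a + 1) (k - j - 1)

/-- Pascal's rule for multisets. The guards in both definitions matter: truncated subtraction would
otherwise give 1 below the threshold. -/
theorem endCountSum_succ (j a k : ℕ) :
    endCountSum j a (k + 1) = endCountSum j a k + endCount j a k := by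
  unfold endCountSum endCount
  rcases lt_trichotomy k j with h | rfl | h
  · rw [if_pos (by omega), if_pos (by omega), if_pos h, add_zero]
  · simp [Nat.multichoose_zero_right]
  · obtain ⟨m, rfl⟩ : ∃ m, k = j + m + 1 := ⟨k - j - 1, by omega⟩
    rw [if_neg (by omega), if_neg (by omega), if_neg (by omega),
      show j + m + 1 + 1 - j - 1 = m + 1 by omega, show j + m + 1 - j = m + 1 by omega,
      Nat.multichoose_succ_succ]
    push_cast
    ring

theorem endCount_succ (j a k : ℕ) :
    endCount j (a + 1) k = endCount j a k + endCountSum j a k := by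
  unfold endCountSum endCount
  rcases lt_trichotomy k j with h | rfl | h
  · rw [if_pos (by omega), if_pos (by omega), if_pos (by omega), add_zero]
  · simp [Nat.multichoose_zero_right]
  · obtain ⟨m, rfl⟩ : ∃ m, k = j + m + 1 := ⟨k - j - 1, by omega⟩
    rw [if_neg (by omega), if_neg (by omega), if_neg (by omega),
      show j + m + 1 - j = m + 1 by omega, Nat.multichoose_succ_succ]
    push_cast
    rfl

theorem endsWith_cons_cons {j : ℕ} {a b : ℕ × ℕ} {L : List (ℕ × ℕ)} :
    EndsWith j (a :: b :: L) ↔ EndsWith j (b :: L) := by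
  simp [EndsWith, LastBlock]

/-- The bound `a ≤ j` makes each inner boundary term vanish. The outer one, `endCount j 0 k`, is the
indicator of $k=j$ and matches the single-block list. -/
theorem count_endsWith {n j : ℕ} (a : ℕ) : ∀ k, a ≤ j → a + 1 ≤ k → k ≤ n →
    (count n (EndsWith j) (a + 1) k : ℤ) = endCount j a k := by
  classical
  induction a using Nat.strong_induction_on with
  | _ a ih =>
  intro k haj hak hkn
  rw [count_eq _ (by omega) hak hkn, sum_Ico_one_succ]
  push_cast
  have h1 : ∀ a' ∈ Finset.Ico 0 a, ∑ j' ∈ Finset.Ico (a' + 1) k,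
      (count n (fun L => EndsWith j ((a + 1, k) :: L)) (a' + 1) j' : ℤ) = endCountSum j a' k := by
    intro a' ha'
    rw [Finset.mem_Ico] at ha'
    rw [Finset.sum_congr rfl (g := fun k' => endCount j a' k') fun k' hk' => by
      rw [Finset.mem_Ico] at hk'
      rw [← ih a' ha'.2 k' (by omega) hk'.1 (by omega)]
      congr 1
      exact count_congr fun L => endsWith_cons_cons]
    rw [sum_Ico_eq_sub (endCountSum_succ j a') (by omega)]
    simp only [endCountSum]
    rw [if_pos (c := a' + 1 ≤ j) (by omega), sub_zero]
  rw [Finset.sum_congr rfl h1, sum_Ico_eq_sub (g := fun a' => endCount j a' k)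
    (fun a' => endCount_succ j a' k) (by omega)]
  have h2 : EndsWith j [(a + 1, k)] ↔ k = j := by simp [EndsWith, LastBlock]
  simp only [h2, endCount]
  rcases lt_trichotomy k j with h | rfl | h
  · simp [h, h.ne]
  · simp
  · obtain ⟨m, rfl⟩ : ∃ m, k = j + m + 1 := ⟨k - j - 1, by omega⟩
    rw [if_neg (by omega), if_neg (by omega), if_neg (by omega),
      show j + m + 1 - j = m + 1 by omega, Nat.multichoose_zero_succ]
    simp

/-! ### Reversal -/

/-- The symmetry `σ_k ↦ σ_{n + 1 - k}` combined with inversion, on lists of blocks. -/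
def flipBlocks (n : ℕ) (L : List (ℕ × ℕ)) : List (ℕ × ℕ) :=
  (L.map fun a => (n + 1 - a.2, n + 1 - a.1)).reverse

theorem isStandard_flipBlocks {n : ℕ} {L : List (ℕ × ℕ)} (hL : IsStandard n L) :
    IsStandard n (flipBlocks n L) := by
  constructor
  · intro a ha
    simp only [flipBlocks, List.mem_reverse, List.mem_map] at ha
    obtain ⟨b, hb, rfl⟩ := ha
    have := hL.1 b hb
    dsimp only; omega
  · rw [flipBlocks, List.pairwise_reverse, List.pairwise_map]
    refine hL.2.imp_of_mem fun {a b} ha hb h => ?_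
    have := hL.1 a ha
    have := hL.1 b hb
    dsimp only; omega

theorem flipBlocks_flipBlocks {n : ℕ} {L : List (ℕ × ℕ)} (hL : IsStandard n L) :
    flipBlocks n (flipBlocks n L) = L := by
  simp only [flipBlocks, List.map_reverse, List.reverse_reverse, List.map_map]
  conv_rhs => rw [← List.map_id L]
  refine List.map_congr_left fun a ha => ?_
  have := hL.1 a ha
  ext <;> simp <;> omega

theorem ncard_flipBlocks (n : ℕ) (P Q : List (ℕ × ℕ) → Prop)
    (h : ∀ L, IsStandard n L → (P (flipBlocks n L) ↔ Q L)) :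
    {L | IsStandard n L ∧ P L}.ncard = {L | IsStandard n L ∧ Q L}.ncard := by
  have : {L | IsStandard n L ∧ P L} = flipBlocks n '' {L | IsStandard n L ∧ Q L} := by
    ext L
    constructor
    · rintro ⟨hL, hP⟩
      refine ⟨flipBlocks n L, ⟨isStandard_flipBlocks hL, ?_⟩, flipBlocks_flipBlocks hL⟩
      rwa [← h _ (isStandard_flipBlocks hL), flipBlocks_flipBlocks hL]
    · rintro ⟨L, ⟨hL, hQ⟩, rfl⟩
      exact ⟨isStandard_flipBlocks hL, (h L hL).2 hQ⟩
  rw [this]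
  refine Set.InjOn.ncard_image ?_
  rintro L ⟨hL, -⟩ L' ⟨hL', -⟩ h
  rw [← flipBlocks_flipBlocks hL, h, flipBlocks_flipBlocks hL']

theorem lastBlock_flipBlocks {n i j : ℕ} (hi : i ≤ n) (hj : j ≤ n) {L : List (ℕ × ℕ)}
    (hL : IsStandard n L) :
    LastBlock i j (flipBlocks n L) ↔ FirstBlock (n + 1 - j) (n + 1 - i) L := by
  simp only [LastBlock, FirstBlock, flipBlocks, List.getLast?_reverse, List.head?_map]
  rcases L with _ | ⟨⟨a, b⟩, L⟩
  · simp
  · have := hL.1 _ List.mem_cons_self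
    simp only [List.head?_cons, Option.map_some, Option.some.injEq, Prod.mk.injEq] at this ⊢
    omega

theorem endsWith_flipBlocks {n j : ℕ} (hj : j ≤ n) {L : List (ℕ × ℕ)} (hL : IsStandard n L) :
    EndsWith j (flipBlocks n L) ↔ StartsWith (n + 1 - j) L := by
  simp only [EndsWith, StartsWith, LastBlock, FirstBlock, flipBlocks, List.getLast?_reverse,
    List.head?_map]
  rcases L with _ | ⟨⟨a, b⟩, L⟩
  · simp
  · have := hL.1 _ List.mem_cons_self
    simp only [List.head?_cons, Option.map_some, Option.some.injEq, Prod.mk.injEq,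
      exists_eq_left', exists_and_left, exists_eq', and_true] at this ⊢
    omega

theorem length_flipBlocks (n : ℕ) (L : List (ℕ × ℕ)) : (flipBlocks n L).length = L.length := by
  simp [flipBlocks]

/-! ### The counting formulas for standard lists -/

theorem ncard_firstBlock {n i j : ℕ} (hi : 1 ≤ i) (hij : i ≤ j) (hj : j ≤ n) :
    ({L | IsStandard n L ∧ FirstBlock i j L}.ncard : ℚ) =
      ((j : ℚ) - i + 2) / (j + 1) * (Nat.choose (j + i - 1) j : ℚ) := by
  obtain ⟨a, rfl⟩ : ∃ a, i = a + 1 := ⟨i - 1, by omega⟩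
  have h := count_true (n := n) a j hij hj
  simp only [count, and_true] at h
  have h1 : ({L | IsStandard n L ∧ FirstBlock (a + 1) j L}.ncard : ℚ) = (ballot a j : ℤ) := by
    rw [← h]; simp
  rw [h1, ballot, show j + (a + 1) - 1 = a + j by omega]
  have h2 : ((a + j).choose (j + 1) : ℚ) * (j + 1) = (a + j).choose j * a := by
    have := Nat.choose_succ_right_eq (a + j) j
    rw [Nat.add_sub_cancel] at this
    exact_mod_cast this
  have h3 : (j : ℚ) + 1 ≠ 0 := by positivity
  push_cast
  field_simp
  linear_combination -h2

theorem ncard_length_startsWith {n i p : ℕ} (hi : 1 ≤ i) (hin : i ≤ n) (hp : 1 ≤ p) (hpn : p ≤ n) :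
    ({L | IsStandard n L ∧ L.length = p ∧ StartsWith i L}.ncard : ℚ) =
      ((n : ℚ) + 1 - i) / ((n : ℚ) + 1 - p) *
        (Nat.choose (i - 1) (p - 1) : ℚ) * (Nat.choose n p : ℚ) := by
  obtain ⟨a, rfl⟩ : ∃ a, i = a + 1 := ⟨i - 1, by omega⟩
  obtain ⟨q, rfl⟩ : ∃ q, p = q + 1 := ⟨p - 1, by omega⟩
  have h : ({L | IsStandard n L ∧ L.length = q + 1 ∧ StartsWith (a + 1) L}.ncard : ℤ) =
      narayanaSum q a n := by
    simp only [and_comm (b := StartsWith _ _)]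
    rw [ncard_startsWith, sum_Ico_succ_succ, ← sum_narayana (by omega)]
    push_cast
    refine Finset.sum_congr rfl fun b hb => ?_
    rw [Finset.mem_Ico] at hb
    exact count_length q a b hb.1 (by omega)
  have h1 : ({L | IsStandard n L ∧ L.length = q + 1 ∧ StartsWith (a + 1) L}.ncard : ℚ) =
      (narayanaSum q a n : ℤ) := by
    rw [← h]; simp
  rw [h1, narayanaSum, Nat.add_sub_cancel, Nat.add_sub_cancel]
  -- Here $m=n-p$, so the denominator $n+1-p$ becomes $m+1$.
  obtain ⟨m, rfl⟩ : ∃ m, n = q + m + 1 := ⟨n - q - 1, by omega⟩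
  have h2 : ((q + m + 1).choose (q + 1) : ℚ) * (q + 1) = (q + m + 1).choose q * (m + 1) := by
    have := Nat.choose_succ_right_eq (q + m + 1) q
    rw [show q + m + 1 - q = m + 1 by omega] at this
    exact_mod_cast this
  have h3 : (a.choose (q + 1) : ℚ) * (q + 1) = a.choose q * (a - q) := by
    rcases lt_or_ge a q with haq | haq
    · simp [Nat.choose_eq_zero_of_lt haq, Nat.choose_eq_zero_of_lt (haq.trans (Nat.lt_succ_self q))]
    · have := Nat.choose_succ_right_eq a q
      rw [← Nat.cast_sub haq]
      exact_mod_cast this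
  have h4 : ((q + m + 1 : ℕ) : ℚ) + 1 - (q + 1 : ℕ) = m + 1 := by push_cast; ring
  have h5 : (m : ℚ) + 1 ≠ 0 := by positivity
  have h6 : (q : ℚ) + 1 ≠ 0 := by positivity
  rw [h4]
  push_cast
  rw [eq_div_of_mul_eq h6 h3, eq_div_of_mul_eq h6 h2]
  field_simp
  ring

/-- The correction is the lower boundary term of the sum: for $i=j+1$ it is the value of `endCount`
at $k=j$, as if the empty block $[j+1,j]$ were counted. -/
theorem sum_count_endsWith {n i j : ℕ} (hi : 1 ≤ i) (hij : i ≤ j + 1) (hjn : j ≤ n)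
    (hin : i ≤ n) :
    ({L | IsStandard n L ∧ StartsWith i L ∧ EndsWith j L}.ncard : ℤ) =
      Nat.multichoose i (n - j) - if i = j + 1 then 1 else 0 := by
  obtain ⟨a, rfl⟩ : ∃ a, i = a + 1 := ⟨i - 1, by omega⟩
  rw [ncard_startsWith]
  push_cast
  rw [Finset.sum_congr rfl (g := fun k => endCount j a k) fun k hk => by
    rw [Finset.mem_Ico] at hk
    exact count_endsWith a k (by omega) hk.1 (by omega)]
  rw [sum_Ico_eq_sub (endCountSum_succ j a) (by omega)]
  simp only [endCountSum]
  rw [if_neg (by omega), show n + 1 - j - 1 = n - j by omega]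
  congr 1
  rcases Nat.lt_or_ge a j with h | h
  · rw [if_pos (by omega), if_neg (by omega)]
  · obtain rfl : a = j := by omega
    simp [Nat.multichoose_zero_right]

end FCTypeA

open FCTypeA in
theorem mainTheorem8 {W : Type*} [Group W] {n : ℕ}
    (cs : CoxeterSystem (CoxeterMatrix.A n) W) :
    (∀ i j : ℕ, 1 ≤ i → i ≤ j → j ≤ n →
      ((fcWith cs (FirstBlock i j)).ncard : ℚ) =
          ((j : ℚ) - i + 2) / (j + 1) * (Nat.choose (j + i - 1) j : ℚ) ∧
      ((fcWith cs (LastBlock i j)).ncard : ℚ) =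
          ((j : ℚ) - i + 2) / ((n : ℚ) - i + 2) * (Nat.choose (2 * n + 1 - j - i) (n - j) : ℚ)) ∧
    (∀ i p : ℕ, 1 ≤ i → i ≤ n → 1 ≤ p → p ≤ n →
      ((fcWith cs (fun L => L.length = p ∧ StartsWith i L)).ncard : ℚ) =
          ((n : ℚ) + 1 - i) / ((n : ℚ) + 1 - p) *
            (Nat.choose (i - 1) (p - 1) : ℚ) * (Nat.choose n p : ℚ)) ∧
    (∀ j p : ℕ, 1 ≤ j → j ≤ n → 1 ≤ p → p ≤ n →
      ((fcWith cs (fun L => L.length = p ∧ EndsWith j L)).ncard : ℚ) =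
          (j : ℚ) / ((n : ℚ) + 1 - p) *
            (Nat.choose (n - j) (p - 1) : ℚ) * (Nat.choose n p : ℚ)) ∧
    (∀ i j : ℕ, 1 ≤ i → i ≤ j → j ≤ n →
      (fcWith cs (fun L => StartsWith i L ∧ EndsWith j L)).ncard =
        Nat.choose (n - j + i - 1) (i - 1)) ∧
    (∀ i : ℕ, 2 ≤ i → i ≤ n →
      ((fcWith cs (fun L => StartsWith i L ∧ EndsWith (i - 1) L)).ncard : ℤ) =
        (Nat.choose n (i - 1) : ℤ) - 1) := by
  simp only [ncard_fcWith]
  refine ⟨fun i j hi hij hj => ⟨ncard_firstBlock hi hij hj, ?_⟩,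
    fun i p hi hin hp hpn => ncard_length_startsWith hi hin hp hpn, ?_, ?_, ?_⟩
  · rw [ncard_flipBlocks n _ (FirstBlock (n + 1 - j) (n + 1 - i))
      fun L hL => lastBlock_flipBlocks (by omega) hj hL,
      ncard_firstBlock (by omega) (by omega) (by omega),
      Nat.choose_symm_of_eq_add (b := n - j) (by omega),
      show n + 1 - i + (n + 1 - j) - 1 = 2 * n + 1 - j - i by omega,
      Nat.cast_sub (by omega), Nat.cast_sub (by omega)]
    push_cast
    congr 2 <;> ring
  · intro j p hj hjn hp hpn
    rw [ncard_flipBlocks n _ (fun L => L.length = p ∧ StartsWith (n + 1 - j) L)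
      fun L hL => by rw [length_flipBlocks, endsWith_flipBlocks hjn hL],
      ncard_length_startsWith (by omega) (by omega) hp hpn, Nat.cast_sub (by omega),
      show n + 1 - j - 1 = n - j by omega]
    push_cast
    congr 3
    ring
  · intro i j hi hij hj
    have h := sum_count_endsWith hi (by omega : i ≤ j + 1) hj (by omega)
    rw [if_neg (by omega), sub_zero, Nat.multichoose_eq] at h
    rw [Nat.cast_injective h, add_comm i,
      Nat.choose_symm_of_eq_add (a := n - j) (b := i - 1) (by omega)]
  · intro i hi hin
    have h := sum_count_endsWith (n := n) (i := i) (j := i - 1) (by omega) (by omega) (by omega) hin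
    rw [if_pos (by omega), Nat.multichoose_eq, show i + (n - (i - 1)) - 1 = n by omega,
      Nat.choose_symm (by omega)] at h
    exact h
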